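/- Let $n_1,n_3\ge 1$. For a tensor $\mathcal A\in\mathbb R^{n_1\times n_1\times n_3}$ with frontal slices $A^{(1)},\dots,A^{(n_3)}$ let $\mathtt{bcirc}(\mathcal A)\in\mathbb R^{n_1n_3\times n_1n_3}$ be the block circulant matrix whose block in position $(k,l)$ is $A^{(m)}$ with $m\equiv k-l+1 \pmod{n_3}$, $1\le m\le n_3$, and let $\mathtt{unfold}(\mathcal A)$ be its first block column, with inverse $\mathtt{fold}$. The t-product is $\mathcal A*\mathcal B=\mathtt{fold}(\mathtt{bcirc}(\mathcal A)\,\mathtt{unfold}(\mathcal B))$; the transpose $\mathcal A^{\mathrm T}$ is obtained by transposing each frontal slice and reversing the order of slices $2,\dots,n_3$; a function $f$ of a symmetric tensor is $f(\mathcal A)=\mathtt{fold}(f(\mathtt{bcirc}(\mathcal A))E_1)$, where $E_1$ is the first block column of the identity matrix. Put $|\mathcal A|=(\mathcal A^{\mathrm T}*\mathcal A)^{1/2}$, $\|\mathcal A\|_F=\bigl(\sum_{i,j,k}|a_{ijk}|^2\bigr)^{1/2}$ and $\|\mathcal A\|_2=\|\mathtt{bcirc}(\mathcal A)\|_2$ (largest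 singular value). Let $\|\cdot\|$ be either the Frobenius norm $\|\cdot\|_F$ or the spectral norm $\|\cdot\|_2$, and let $1\le p\le\infty$. Then for all $\mathcal A_1,\mathcal A_2,\mathcal B_1,\mathcal B_2\in\mathbb R^{n_1\times n_1\times n_3}$, $$2^{-\left|\frac1p-\frac12\right|}\bigl\|\,|\mathcal A_1+\mathcal A_2|^p+|\mathcal B_1+\mathcal B_2|^p\,\bigr\|^{1/p}\le\bigl\|\,|\mathcal A_1|^p+|\mathcal B_1|^p\,\bigr\|^{1/p}+\bigl\|\,|\mathcal A_2|^p+|\mathcal B_2|^p\,\bigr\|^{1/p}.$$ For $p=\infty$ we set $1/p=0$, and $\bigl\|\,|\mathcal A|^p+|\mathcal B|^p\,\bigr\|^{1/p}$ means $\lim_{r\to\infty}\bigl\|\,|\mathcal A|^r+|\mathcal B|^r\,\bigr\|^{1/r}$; this limit exists and equals $\max\{\|\mathcal A\|_2,\|\mathcal B\|_2\}$ for either choice of the norm. -/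

import Mathlib

open Filter Topology
open scoped ENNReal

namespace TProduct

/-- A real third-order tensor of size `n₁ × n₂ × n₃`, given by its frontal slices:
`𝒜 k i j` is the entry `a_{ijk}`, with all indices counted from `0`. Addition is entrywise. -/
abbrev Tensor (n₁ n₂ n₃ : ℕ) : Type := Fin n₃ → Matrix (Fin n₁) (Fin n₂) ℝ

/-- The block column whose blocks are the frontal slices. -/
def unfold {n₁ n₂ n₃ : ℕ} (A : Tensor n₁ n₂ n₃) :
    Matrix (Fin n₃ × Fin n₁) (Fin n₂) ℝ :=
  Matrix.of fun ki j => A ki.1 ki.2 j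

/-- The inverse of `unfold`. -/
def fold {n₁ n₂ n₃ : ℕ} (M : Matrix (Fin n₃ × Fin n₁) (Fin n₂) ℝ) :
    Tensor n₁ n₂ n₃ :=
  fun k => Matrix.of fun i j => M (k, i) j

/-- The block circulant matrix of a tensor: the block in position `(k, l)` is the frontal slice
with index `k - l` modulo `n₃`. -/
def bcirc {n₁ n₂ n₃ : ℕ} [NeZero n₃] (A : Tensor n₁ n₂ n₃) :
    Matrix (Fin n₃ × Fin n₁) (Fin n₃ × Fin n₂) ℝ :=
  Matrix.of fun ki lj => A (ki.1 - lj.1) ki.2 lj.2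

/-- The t-product `𝒜 * ℬ = fold (bcirc 𝒜 ⬝ unfold ℬ)`. -/
def tProd {n₁ n₂ n₃ n₄ : ℕ} [NeZero n₃] (A : Tensor n₁ n₂ n₃) (B : Tensor n₂ n₄ n₃) :
    Tensor n₁ n₄ n₃ :=
  fold (bcirc A * unfold B)

/-- The tensor transpose: every frontal slice is transposed, the first slice stays in place and
the order of the others is reversed (slice `k` comes from slice `-k` modulo `n₃`). -/
def tTranspose {n₁ n₂ n₃ : ℕ} [NeZero n₃] (A : Tensor n₁ n₂ n₃) : Tensor n₂ n₁ n₃ :=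
  fun k => (A (-k)).transpose

/-- The identity tensor: the first frontal slice is the identity matrix, the others vanish. -/
def tOne (n n₃ : ℕ) [NeZero n₃] : Tensor n n n₃ :=
  fun k => if k = 0 then 1 else 0

/-- The tensor t-function `f(𝒜) = fold (f(bcirc 𝒜) ⬝ E₁)`, where `E₁` is the first block column
of the identity matrix. The matrix function is the spectral (functional calculus) one, and it is
used here only for symmetric tensors, whose block circulant matrix is symmetric. -/
noncomputable def tFun {n n₃ : ℕ} [NeZero n₃] (f : ℝ → ℝ) (A : Tensor n n n₃) : Tensor n n n₃ :=
  fold (cfc f (bcirc A) * unfold (tOne n n₃))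

/-- The power `𝒜 ^ r` of a symmetric t-positive semidefinite tensor. -/
noncomputable def tPow {n n₃ : ℕ} [NeZero n₃] (A : Tensor n n n₃) (r : ℝ) : Tensor n n n₃ :=
  tFun (fun x => x ^ r) A

/-- `|𝒜| = (𝒜ᵀ * 𝒜) ^ (1/2)`. -/
noncomputable def tAbs {n n₃ : ℕ} [NeZero n₃] (A : Tensor n n n₃) : Tensor n n n₃ :=
  tPow (tProd (tTranspose A) A) (1 / 2)

/-- The Frobenius norm. -/
noncomputable def frobNorm {n₁ n₂ n₃ : ℕ} (A : Tensor n₁ n₂ n₃) : ℝ :=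
  Real.sqrt (∑ i, ∑ j, ∑ k, |A k i j| ^ 2)

open scoped Matrix.Norms.L2Operator in
/-- The spectral norm: the largest singular value (`ℓ²` operator norm) of the block circulant
matrix. -/
noncomputable def specNorm {n₁ n₂ n₃ : ℕ} [NeZero n₃] (A : Tensor n₁ n₂ n₃) : ℝ :=
  ‖bcirc A‖

/-- `N(|𝒜|^r + |ℬ|^r)^{1/r}` for a finite exponent `r`. -/
noncomputable def powNormReal {n n₃ : ℕ} [NeZero n₃] (N : Tensor n n n₃ → ℝ) (r : ℝ)
    (A B : Tensor n n n₃) : ℝ :=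
  N (tPow (tAbs A) r + tPow (tAbs B) r) ^ (1 / r)

/-- `N(|𝒜|^p + |ℬ|^p)^{1/p}` for an extended exponent `p`; at `p = ∞` it is the limit of the
values at finite exponents. -/
noncomputable def powNorm {n n₃ : ℕ} [NeZero n₃] (N : Tensor n n n₃ → ℝ) (p : ℝ≥0∞)
    (A B : Tensor n n n₃) : ℝ :=
  if p = ∞ then limUnder atTop (fun r : ℝ => powNormReal N r A B)
  else powNormReal N p.toReal A B

end TProduct

/-!
The block circulant map turns the t-product, the tensor transpose and t-functions into the matrix
product, the transpose and the functional calculus (`bcirc_tProd`, `bcirc_tTranspose`,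
`bcirc_tFun`). The Frobenius norm becomes a fixed multiple of the matrix Frobenius norm. So the
claim concerns real square matrices `A`, `B` and the quantity
`H(A, B) = g((AᵀA)^(p/2) + (BᵀB)^(p/2))^(1/p)`, where `g` is the Frobenius or the operator norm.

`H` need not satisfy the triangle inequality, but it is within the factor `2^|1/p - 1/2|` of
`h(AᵀA + BᵀB)^(1/2)`, which does: here `h` is the Schatten `p`-norm if `g` is the Frobenius norm,
and the operator norm if `g` is the operator norm, so that `h(AᵀA + BᵀB)^(1/2)` is the Schatten
`2p`-norm, or the operator norm, of the stacked matrix `[A; B]` (`schatten_triangle`,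
`norm_gram_triangle`). One of the two bounds in this comparison holds with constant `1`, so the
factor enters the final inequality only once (`minkowski_of_powerComparison`).

For the Schatten norms the comparison (`powerComparison_schatten`) is the pair of inequalities
`tr (A+B)^(rq) ≤ tr (A^r + B^r)^q ≤ 2^((1-r)q) tr (A+B)^(rq)` for positive semidefinite `A`, `B`
with `0 < r ≤ 1 ≤ q` and `1 ≤ rq`, applied with `r = p/2` if `p ≤ 2` and, to the powers `A^(p/2)`
and `B^(p/2)`, with `r = 2/p` if `p ≥ 2`. The right inequality is Jensen's inequality in the
eigenbasis of `A^r + B^r`. The left one follows by Young's and Peierls' inequalities from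
`tr Z^(b+r) ≤ tr Z^b (A^r + B^r)` with `Z = A + B` and `b = r(q-1)` (`trace_mpow_add_le`). To see
this for invertible `A` and `B`, note that `A ≤ Z` gives `A^(r-1) ≥ Z^(r-1)` by Löwner–Heinz, so
that `A^r ≥ A^(1/2) Z^(r-1) A^(1/2)`. Then `tr Z^b A^(1/2) Z^(r-1) A^(1/2) ≥ tr Z^(b+r-1) A`,
because one of the two powers of `Z` is increasing and the other decreasing
(`trace_mpow_mul_le`). Adding the same bound for `B` gives the claim.

For `p = ∞`, `‖(AᵀA)^(r/2) + (BᵀB)^(r/2)‖` lies between `m^r` and `2 m^r`, where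
`m = max ‖A‖ ‖B‖`. The `r`-th root removes constants, so every norm equivalent to the operator norm
yields the limit `m` (`tendsto_powNormReal`), and `m` is itself subadditive in the pair `(A, B)`.
-/

namespace TProduct
open Matrix

section RealMatrices

variable {m : Type*} [Fintype m]

/-! ### Quadratic forms -/

/-- The quadratic form `e ↦ ⟨e, M e⟩` of a real matrix. -/
def qform (M : Matrix m m ℝ) (e : m → ℝ) : ℝ := e ⬝ᵥ M *ᵥ e

theorem qform_add (M M' : Matrix m m ℝ) (e : m → ℝ) :
    qform (M + M') e = qform M e + qform M' e := by
  simp [qform, add_mulVec, dotProduct_add]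

theorem qform_row (M W : Matrix m m ℝ) (i : m) : qform M (W i) = (W * M * Wᵀ) i i := by
  rw [Matrix.mul_assoc]
  simp [qform, mul_apply, dotProduct, mulVec]

theorem qform_nonneg {M : Matrix m m ℝ} (hM : M.PosSemidef) (e : m → ℝ) : 0 ≤ qform M e := by
  simpa using! hM.dotProduct_mulVec_nonneg e

theorem posSemidef_gram (A : Matrix m m ℝ) : (Aᵀ * A).PosSemidef := by
  simpa using! posSemidef_conjTranspose_mul_self A

theorem posSemidef_gram_add (A B : Matrix m m ℝ) : (Aᵀ * A + Bᵀ * B).PosSemidef :=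
  (posSemidef_gram A).add (posSemidef_gram B)

/-- Triangle inequality for the length of the stacked vector `(A e, B e)`. -/
theorem sqrt_qform_triangle (A₁ A₂ B₁ B₂ : Matrix m m ℝ) (e : m → ℝ) :
    qform ((A₁ + A₂)ᵀ * (A₁ + A₂) + (B₁ + B₂)ᵀ * (B₁ + B₂)) e ^ (1 / 2 : ℝ) ≤
      qform (A₁ᵀ * A₁ + B₁ᵀ * B₁) e ^ (1 / 2 : ℝ) +
      qform (A₂ᵀ * A₂ + B₂ᵀ * B₂) e ^ (1 / 2 : ℝ) := by
  set v : Matrix m m ℝ → Matrix m m ℝ → EuclideanSpace ℝ (m ⊕ m) :=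
    fun A B => WithLp.toLp 2 (Sum.elim (A *ᵥ e) (B *ᵥ e)) with hv
  have hq : ∀ A B, qform (Aᵀ * A + Bᵀ * B) e ^ (1 / 2 : ℝ) = ‖v A B‖ := by
    intro A B
    have : ∀ C : Matrix m m ℝ, qform (Cᵀ * C) e = ∑ i, (C *ᵥ e) i ^ 2 := fun C => by
      rw [qform, ← mulVec_mulVec, dotProduct_mulVec, vecMul_transpose]
      simp [dotProduct, sq]
    rw [qform_add, this, this, EuclideanSpace.norm_eq, Real.sqrt_eq_rpow]
    simp [hv]
  have hadd : v (A₁ + A₂) (B₁ + B₂) = v A₁ B₁ + v A₂ B₂ := by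
    ext i; rcases i with i | i <;> simp [hv, add_mulVec]
  rw [hq, hq, hq, hadd]
  exact norm_add_le _ _

variable [DecidableEq m]

/-! ### Spectral calculus of real symmetric matrices -/

/-- The real power of a positive semidefinite matrix, defined by functional calculus. For `r < 0`
it is the usual power only if the matrix is invertible, as `0 ^ r = 0` for such `r`. -/
noncomputable def mpow (M : Matrix m m ℝ) (r : ℝ) : Matrix m m ℝ := cfc (fun x : ℝ => x ^ r) M

/-- The spectral theorem, simultaneously for all functions of `M`: the rows of `W` are eigenvectors.
No continuity is asked of `f`, since the spectrum is finite. -/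
theorem exists_spectral {M : Matrix m m ℝ} (hM : M.IsHermitian) :
    ∃ W : Matrix m m ℝ, W * Wᵀ = 1 ∧ Wᵀ * W = 1 ∧
      ∀ f : ℝ → ℝ, cfc f M = Wᵀ * diagonal (fun i => f (hM.eigenvalues i)) * W := by
  refine ⟨(hM.eigenvectorUnitary : Matrix m m ℝ)ᵀ, ?_, ?_, fun f => ?_⟩
  · have := Unitary.coe_star_mul_self hM.eigenvectorUnitary
    simpa [star_eq_conjTranspose] using this
  · have := Unitary.coe_mul_star_self hM.eigenvectorUnitary
    simpa [star_eq_conjTranspose] using this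
  · rw [hM.cfc_eq, IsHermitian.cfc, Unitary.conjStarAlgAut_apply]
    simp [star_eq_conjTranspose, Function.comp_def]

theorem cfc_id_matrix {M : Matrix m m ℝ} (hM : M.IsHermitian) : cfc (fun x : ℝ => x) M = M :=
  cfc_id' ℝ M hM

theorem row_dotProduct_self {W : Matrix m m ℝ} (hW : W * Wᵀ = 1) (i : m) : W i ⬝ᵥ W i = 1 := by
  have := congrFun (congrFun hW i) i
  simpa [mul_apply, dotProduct] using this

theorem sum_qform_row (M : Matrix m m ℝ) {W : Matrix m m ℝ} (hW : Wᵀ * W = 1) :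
    ∑ i, qform M (W i) = M.trace := by
  simp_rw [qform_row]
  change (W * M * Wᵀ).trace = _
  rw [trace_mul_comm, ← Matrix.mul_assoc, hW, Matrix.one_mul]

/-- An orthonormal eigenbasis, as the rows of an orthogonal matrix. -/
theorem exists_eigenrows {M : Matrix m m ℝ} (hM : M.IsHermitian) :
    ∃ W : Matrix m m ℝ, W * Wᵀ = 1 ∧ Wᵀ * W = 1 ∧
      ∀ (f : ℝ → ℝ) (i : m), qform (cfc f M) (W i) = f (hM.eigenvalues i) := by
  obtain ⟨W, h1, h2, h⟩ := exists_spectral hM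
  refine ⟨W, h1, h2, fun f i => ?_⟩
  have : W * cfc f M * Wᵀ = diagonal fun i => f (hM.eigenvalues i) := by
    rw [h, Matrix.mul_assoc, Matrix.mul_assoc, h1, Matrix.mul_one, ← Matrix.mul_assoc, h1,
      Matrix.one_mul]
  rw [qform_row, this, diagonal_apply_eq]

/-- In a unit vector state, functional calculus is an average over the eigenvalues, with weights
independent of the function. -/
theorem exists_qform_cfc {M : Matrix m m ℝ} (hM : M.IsHermitian) {e : m → ℝ} (he : e ⬝ᵥ e = 1) :
    ∃ c : m → ℝ, (∀ j, 0 ≤ c j) ∧ ∑ j, c j = 1 ∧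
      ∀ f : ℝ → ℝ, qform (cfc f M) e = ∑ j, c j * f (hM.eigenvalues j) := by
  obtain ⟨W, h1, h2, h⟩ := exists_spectral hM
  refine ⟨fun j => (W *ᵥ e) j ^ 2, fun j => sq_nonneg _, ?_, fun f => ?_⟩
  · have : (W *ᵥ e) ⬝ᵥ (W *ᵥ e) = 1 := by
      rw [dotProduct_mulVec, vecMul_mulVec, ← dotProduct_mulVec, h2, one_mulVec, he]
    rw [← this]; simp [dotProduct, sq]
  · rw [qform, h, ← mulVec_mulVec, ← mulVec_mulVec, dotProduct_mulVec, vecMul_transpose]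
    simp only [dotProduct, mulVec_diagonal]
    exact Finset.sum_congr rfl fun j _ => by ring

theorem qform_eq_sum {M : Matrix m m ℝ} (hM : M.IsHermitian) {e : m → ℝ} {c : m → ℝ}
    (h : ∀ f : ℝ → ℝ, qform (cfc f M) e = ∑ j, c j * f (hM.eigenvalues j)) :
    qform M e = ∑ j, c j * hM.eigenvalues j := by
  simpa [cfc_id_matrix hM] using h fun x => x

theorem trace_cfc {M : Matrix m m ℝ} (hM : M.IsHermitian) (f : ℝ → ℝ) :
    (cfc f M).trace = ∑ i, f (hM.eigenvalues i) := by
  obtain ⟨W, h1, h2, h⟩ := exists_eigenrows hM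
  rw [← sum_qform_row _ h2]
  exact Finset.sum_congr rfl fun i _ => h f i

/-- Jensen's inequality in a vector state, for convex powers. -/
theorem qform_rpow_le {M : Matrix m m ℝ} (hM : M.PosSemidef) {e : m → ℝ} (he : e ⬝ᵥ e = 1)
    {q : ℝ} (hq : 1 ≤ q) : qform M e ^ q ≤ qform (mpow M q) e := by
  obtain ⟨c, hc0, hc1, hc⟩ := exists_qform_cfc hM.1 he
  rw [qform_eq_sum hM.1 hc, mpow, hc]
  simpa using (convexOn_rpow hq).map_sum_le (t := Finset.univ) (fun j _ => hc0 j) hc1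
    (fun j _ => hM.eigenvalues_nonneg j)

/-- Jensen's inequality in a vector state, for concave powers. -/
theorem qform_mpow_le {M : Matrix m m ℝ} (hM : M.PosSemidef) {e : m → ℝ} (he : e ⬝ᵥ e = 1)
    {r : ℝ} (h0 : 0 ≤ r) (h1 : r ≤ 1) : qform (mpow M r) e ≤ qform M e ^ r := by
  obtain ⟨c, hc0, hc1, hc⟩ := exists_qform_cfc hM.1 he
  rw [qform_eq_sum hM.1 hc, mpow, hc]
  simpa using (Real.concaveOn_rpow h0 h1).le_map_sum (t := Finset.univ) (fun j _ => hc0 j) hc1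
    (fun j _ => hM.eigenvalues_nonneg j)

/-- Peierls' inequality for powers: the diagonal of `M` in any orthonormal basis, here the rows of
`W`, has smaller convex power sums than the spectrum. -/
theorem sum_qform_rpow_le_trace {M : Matrix m m ℝ} (hM : M.PosSemidef) {W : Matrix m m ℝ}
    (h1 : W * Wᵀ = 1) (h2 : Wᵀ * W = 1) {q : ℝ} (hq : 1 ≤ q) :
    ∑ i, qform M (W i) ^ q ≤ (mpow M q).trace := by
  rw [← sum_qform_row _ h2]
  exact Finset.sum_le_sum fun i _ => qform_rpow_le hM (row_dotProduct_self h1 i) hq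

theorem posSemidef_mpow {M : Matrix m m ℝ} (hM : M.PosSemidef) (r : ℝ) :
    (mpow M r).PosSemidef := by
  obtain ⟨W, -, -, h⟩ := exists_spectral hM.1
  rw [mpow, h]
  simpa using! (PosSemidef.diagonal (d := fun i => hM.1.eigenvalues i ^ r)
    fun i => Real.rpow_nonneg (hM.eigenvalues_nonneg i) _).conjTranspose_mul_mul_same W

/-- Functions of a real symmetric matrix compose, with no continuity requirement: the spectrum is
finite. -/
theorem cfc_cfc {M : Matrix m m ℝ} (hM : M.IsHermitian) (f g : ℝ → ℝ) :
    cfc g (cfc f M) = cfc (fun x => g (f x)) M :=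
  (cfc_comp' g f M (((finite_real_spectrum (A := M)).image f).continuousOn _)
    ((finite_real_spectrum (A := M)).continuousOn _) hM).symm

theorem cfc_congr_eigenvalues {M : Matrix m m ℝ} (hM : M.IsHermitian) {f g : ℝ → ℝ}
    (h : ∀ i, f (hM.eigenvalues i) = g (hM.eigenvalues i)) : cfc f M = cfc g M := by
  obtain ⟨W, -, -, hW⟩ := exists_spectral hM
  simp only [hW, h]

theorem mpow_mpow {M : Matrix m m ℝ} (hM : M.PosSemidef) (r s : ℝ) :
    mpow (mpow M r) s = mpow M (r * s) := by
  rw [mpow, mpow, cfc_cfc hM.1, mpow]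
  exact cfc_congr_eigenvalues hM.1 fun i => (Real.rpow_mul (hM.eigenvalues_nonneg i) r s).symm

theorem mpow_one {M : Matrix m m ℝ} (hM : M.PosSemidef) : mpow M 1 = M := by
  simp [mpow, cfc_id_matrix hM.1]

theorem cfc_mul_cfc {M : Matrix m m ℝ} (f g : ℝ → ℝ) :
    cfc f M * cfc g M = cfc (fun x => f x * g x) M :=
  (cfc_mul f g M ((finite_real_spectrum (A := M)).continuousOn _)
    ((finite_real_spectrum (A := M)).continuousOn _)).symm

theorem mpow_mul_mpow {M : Matrix m m ℝ} (hM : M.PosDef) (r s : ℝ) :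
    mpow M r * mpow M s = mpow M (r + s) := by
  rw [mpow, mpow, cfc_mul_cfc, mpow]
  exact cfc_congr_eigenvalues hM.1 fun i => (Real.rpow_add (hM.eigenvalues_pos i) r s).symm

/-- The trace of a product of functions of two symmetric matrices. The weights do not depend on the
functions, so the trace inherits continuity from parameters of `f` and `g`. -/
theorem exists_trace_cfc_mul_cfc {M L : Matrix m m ℝ} (hM : M.IsHermitian) (hL : L.IsHermitian) :
    ∃ c : m → m → ℝ, ∀ f g : ℝ → ℝ, (cfc f M * cfc g L).trace
      = ∑ i, ∑ j, c i j * (f (hM.eigenvalues i) * g (hL.eigenvalues j)) := by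
  obtain ⟨W, h1, h2, h⟩ := exists_spectral hM
  have := fun i => exists_qform_cfc hL (row_dotProduct_self h1 i)
  choose c _ _ hc using this
  refine ⟨c, fun f g => ?_⟩
  have e : (cfc f M * cfc g L).trace
      = ∑ i, f (hM.eigenvalues i) * qform (cfc g L) (W i) := by
    simp_rw [qform_row]
    rw [h, Matrix.mul_assoc, Matrix.mul_assoc, trace_mul_comm, Matrix.mul_assoc, trace]
    simp [diagonal_mul]
  rw [e]
  refine Finset.sum_congr rfl fun i _ => ?_
  rw [hc, Finset.mul_sum]
  exact Finset.sum_congr rfl fun j _ => by ring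

theorem trace_mul_nonneg {M L : Matrix m m ℝ} (hM : M.PosSemidef) (hL : L.PosSemidef) :
    0 ≤ (M * L).trace := by
  obtain ⟨W, h1, h2, h⟩ := exists_spectral hM.1
  rw [← cfc_id_matrix hM.1, h, Matrix.mul_assoc, Matrix.mul_assoc, trace_mul_comm,
    Matrix.mul_assoc, trace]
  refine Finset.sum_nonneg fun i _ => ?_
  rw [diag_apply, diagonal_mul, ← qform_row]
  exact mul_nonneg (hM.eigenvalues_nonneg i) (qform_nonneg hL _)

/-! ### Operator antitone powers -/

/-- Entrywise inclusion of real matrices into complex matrices. -/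
noncomputable def toComplex : Matrix m m ℝ →⋆ₐ[ℝ] Matrix m m ℂ :=
  { (Complex.ofRealAm.mapMatrix : Matrix m m ℝ →ₐ[ℝ] Matrix m m ℂ) with
    map_star' := fun M => by ext i j; simp [star_apply] }

theorem toComplex_apply (M : Matrix m m ℝ) (i j : m) : toComplex M i j = (M i j : ℂ) := rfl

open scoped MatrixOrder ComplexOrder in
theorem posSemidef_toComplex {M : Matrix m m ℝ} (hM : M.PosSemidef) :
    (toComplex M).PosSemidef := by
  obtain ⟨B, rfl⟩ := CStarAlgebra.nonneg_iff_eq_star_mul_self.mp (nonneg_iff_posSemidef.mpr hM)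
  rw [map_mul, map_star]
  exact posSemidef_conjTranspose_mul_self _

open scoped ComplexOrder in
theorem posSemidef_of_toComplex {M : Matrix m m ℝ} (hM : (toComplex M).PosSemidef) :
    M.PosSemidef := by
  refine .of_dotProduct_mulVec_nonneg ?_ fun x => ?_
  · ext i j
    have := congrFun (congrFun hM.1 i) j
    simpa [toComplex_apply] using this
  · have h := hM.dotProduct_mulVec_nonneg (fun i => (x i : ℂ))
    have e : star (fun i => (x i : ℂ)) ⬝ᵥ toComplex M *ᵥ (fun i => (x i : ℂ))
        = ((star x ⬝ᵥ M *ᵥ x : ℝ) : ℂ) := by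
      simp [dotProduct, mulVec, toComplex_apply]
    rw [e] at h
    exact_mod_cast h

open scoped MatrixOrder ComplexOrder Matrix.Norms.L2Operator in
/-- **Löwner–Heinz**: for `-1 ≤ t < 0` the power `x ^ t` is operator antitone. The real matrices
are viewed as complex ones, which form a C⋆-algebra; there `x ^ t` is the inverse of the operator
monotone power `x ^ (-t)`. -/
theorem mpow_antitone {A Z : Matrix m m ℝ} (hA : A.PosDef) (hZ : Z.PosDef)
    (hAZ : (Z - A).PosSemidef) {t : ℝ} (h1 : -1 ≤ t) (h0 : t < 0) :
    (mpow A t - mpow Z t).PosSemidef := by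
  have key : ∀ {M : Matrix m m ℝ}, M.PosDef →
      toComplex (mpow M t) = (toComplex M) ^ t := by
    intro M hM
    have hc := posSemidef_toComplex hM.posSemidef
    have : 0 ≤ toComplex M := nonneg_iff_posSemidef.mpr hc
    rw [CFC.rpow_eq_cfc_real this, mpow]
    have hcont : Continuous (toComplex : Matrix m m ℝ →⋆ₐ[ℝ] Matrix m m ℂ) :=
      LinearMap.continuous_of_finiteDimensional
        (toComplex : Matrix m m ℝ →⋆ₐ[ℝ] Matrix m m ℂ).toAlgHom.toLinearMap
    exact StarAlgHom.map_cfc (R := ℝ) (S := ℝ) (q := IsSelfAdjoint) (p := IsSelfAdjoint)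
      (toComplex : Matrix m m ℝ →⋆ₐ[ℝ] Matrix m m ℂ) (fun x : ℝ => x ^ t) M
      ((Matrix.finite_real_spectrum (A := M)).continuousOn _) hcont hM.1.isSelfAdjoint
      hc.1.isSelfAdjoint
  have hu : ∀ {M : Matrix m m ℝ}, M.PosDef → IsStrictlyPositive (toComplex M) := fun hM =>
    (IsStrictlyPositive.iff_of_unital).mpr
      ⟨nonneg_iff_posSemidef.mpr (posSemidef_toComplex hM.posSemidef), hM.isUnit.map toComplex⟩
  have hle : toComplex A ≤ toComplex Z := by
    rw [le_iff, ← map_sub]; exact posSemidef_toComplex hAZ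
  have := CStarAlgebra.rpow_neg_one_le_rpow_neg_one
    (CFC.rpow_le_rpow (p := -t) ⟨by linarith, by linarith⟩ hle) ((hu hA).rpow _ _)
  rw [CFC.rpow_rpow _ _ _ (by linarith) (hu hA), CFC.rpow_rpow _ _ _ (by linarith) (hu hZ)] at this
  apply posSemidef_of_toComplex
  rw [map_sub, key hA, key hZ, ← le_iff]
  simpa using this

/-! ### A trace rearrangement inequality -/

/-- Among the orderings of powers of `Z` around a symmetric `P`, spreading an increasing and a
decreasing power to the two sides of `P` gives the larger trace. -/
theorem trace_mpow_mul_le {Z P : Matrix m m ℝ} (hZ : Z.PosDef) (hP : P.IsHermitian) {b t : ℝ}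
    (hb : 0 ≤ b) (ht : t ≤ 0) :
    (mpow Z (b + t) * (P * P)).trace ≤ (mpow Z b * (P * mpow Z t * P)).trace := by
  obtain ⟨W, h1, h2, h⟩ := exists_spectral hZ.1
  set S := W * P * Wᵀ with hS
  have hSs : ∀ i j, S j i = S i j := by
    have : Sᵀ = S := by
      simp only [hS, transpose_mul, transpose_transpose, Matrix.mul_assoc]
      rw [show Pᵀ = P from hP]
    intro i j; exact congrFun (congrFun this i) j
  -- both traces in the eigenbasis of `Z`
  have e : ∀ f g : ℝ → ℝ, (cfc f Z * (P * cfc g Z * P)).trace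
      = ∑ i, ∑ j, S i j ^ 2 * (f (hZ.1.eigenvalues i) * g (hZ.1.eigenvalues j)) := by
    intro f g
    have : (cfc f Z * (P * cfc g Z * P)).trace
        = (diagonal (fun i => f (hZ.1.eigenvalues i)) *
          (S * (diagonal (fun i => g (hZ.1.eigenvalues i)) * S))).trace := by
      rw [h, h, Matrix.mul_assoc, Matrix.mul_assoc, trace_mul_comm]
      simp only [hS, Matrix.mul_assoc]
    rw [this, trace]
    refine Finset.sum_congr rfl fun i _ => ?_
    rw [diag_apply, diagonal_mul, mul_apply, Finset.mul_sum]
    refine Finset.sum_congr rfl fun j _ => ?_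
    rw [diagonal_mul, hSs i j]; ring
  have e1 : mpow Z (b + t) * (P * P) = cfc (fun x : ℝ => x ^ (b + t)) Z *
      (P * cfc (fun _ : ℝ => (1 : ℝ)) Z * P) := by
    have one : cfc (fun _ : ℝ => (1 : ℝ)) Z = 1 := cfc_const_one ℝ Z (ha := hZ.1)
    rw [one, Matrix.mul_one, mpow]
  rw [e1, e, mpow, mpow, e]
  have hpos := hZ.eigenvalues_pos
  set z := hZ.1.eigenvalues
  -- symmetrize the double sum of differences
  have hsymm : ∑ i, ∑ j, S i j ^ 2 * (z i ^ b * z j ^ t - z i ^ b * z i ^ t)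
      = ∑ i, ∑ j, S i j ^ 2 * (z j ^ b * z i ^ t - z j ^ b * z j ^ t) := by
    rw [Finset.sum_comm]
    exact Finset.sum_congr rfl fun i _ => Finset.sum_congr rfl fun j _ => by rw [hSs]
  have hnn : 0 ≤ ∑ i, ∑ j, (S i j ^ 2 * (z i ^ b * z j ^ t - z i ^ b * z i ^ t) +
      S i j ^ 2 * (z j ^ b * z i ^ t - z j ^ b * z j ^ t)) := by
    refine Finset.sum_nonneg fun i _ => Finset.sum_nonneg fun j _ => ?_
    have : 0 ≤ (z i ^ b - z j ^ b) * (z j ^ t - z i ^ t) := by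
      rcases le_total (z i) (z j) with hij | hij
      · exact mul_nonneg_of_nonpos_of_nonpos
          (sub_nonpos.2 (Real.rpow_le_rpow (hpos i).le hij hb))
          (sub_nonpos.2 (Real.rpow_le_rpow_of_nonpos (hpos i) hij ht))
      · exact mul_nonneg (sub_nonneg.2 (Real.rpow_le_rpow (hpos j).le hij hb))
          (sub_nonneg.2 (Real.rpow_le_rpow_of_nonpos (hpos j) hij ht))
    nlinarith [mul_nonneg (sq_nonneg (S i j)) this]
  simp only [Finset.sum_add_distrib] at hnn
  rw [← hsymm] at hnn
  have : ∑ i, ∑ j, S i j ^ 2 * (z i ^ b * z j ^ t - z i ^ b * z i ^ t)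
      = ∑ i, ∑ j, S i j ^ 2 * (z i ^ b * z j ^ t)
        - ∑ i, ∑ j, S i j ^ 2 * (z i ^ (b + t) * 1) := by
    simp only [← Finset.sum_sub_distrib]
    refine Finset.sum_congr rfl fun i _ => Finset.sum_congr rfl fun j _ => ?_
    rw [Real.rpow_add (hpos i)]; ring
  linarith

/-- The contribution of one summand `A` of `Z` to the subadditivity of the concave power `x ^ r`,
weighted by a power of `Z`. -/
theorem trace_mpow_mul_le_of_le {A Z : Matrix m m ℝ} (hA : A.PosDef) (hZ : Z.PosDef)
    (hAZ : (Z - A).PosSemidef) {b r : ℝ} (hb : 0 ≤ b) (h0 : 0 ≤ r) (h1 : r < 1) :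
    (mpow Z (b + (r - 1)) * A).trace ≤ (mpow Z b * mpow A r).trace := by
  have hP := posSemidef_mpow hA.posSemidef (1 / 2)
  set P := mpow A (1 / 2) with hPdef
  have hPP : P * P = A := by
    rw [hPdef, mpow_mul_mpow hA]; norm_num; exact mpow_one hA.posSemidef
  have hAr : mpow A r = P * mpow A (r - 1) * P := by
    rw [hPdef, mpow_mul_mpow hA, mpow_mul_mpow hA]; congr 1; ring
  -- `A ^ r - P Z ^ (r - 1) P` is positive semidefinite, as `A ≤ Z` and `x ^ (r - 1)` is antitone
  have hd : 0 ≤ (mpow Z b * (P * (mpow A (r - 1) - mpow Z (r - 1)) * P)).trace := by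
    refine trace_mul_nonneg (posSemidef_mpow hZ.posSemidef b) ?_
    have := (mpow_antitone hA hZ hAZ (t := r - 1) (by linarith)
      (by linarith)).conjTranspose_mul_mul_same P
    rwa [hP.1] at this
  rw [Matrix.mul_sub, Matrix.sub_mul, Matrix.mul_sub, trace_sub, ← hAr] at hd
  have := trace_mpow_mul_le hZ hP.1 hb (t := r - 1) (by linarith)
  rw [hPP] at this
  linarith

/-! ### Trace inequalities for concave powers -/

theorem cfc_add_smul_one {M : Matrix m m ℝ} (hM : M.IsHermitian) (ε : ℝ) (f : ℝ → ℝ) :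
    cfc f (M + ε • (1 : Matrix m m ℝ)) = cfc (fun x => f (x + ε)) M := by
  have h : cfc (fun x : ℝ => x + ε) M = M + ε • (1 : Matrix m m ℝ) := by
    obtain ⟨W, h1, h2, hW⟩ := exists_spectral hM
    have e : (diagonal fun i => hM.eigenvalues i + ε) =
        diagonal (fun i => hM.eigenvalues i) + ε • (1 : Matrix m m ℝ) := by
      ext i j; by_cases hij : i = j <;> simp [hij, one_apply]
    conv_rhs => rw [← cfc_id_matrix hM]
    rw [hW, hW, e, Matrix.mul_add, Matrix.add_mul]
    simp [h2]
  rw [← h, cfc_cfc hM]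

/-- Subadditivity of the concave power `x ^ r` under the trace against an increasing power of the
sum. Adding `ε` to both matrices makes the negative power `x ^ (r - 1)` available; then `ε → 0`. -/
theorem trace_mpow_add_le {A B : Matrix m m ℝ} (hA : A.PosSemidef) (hB : B.PosSemidef)
    {b r : ℝ} (hb : 0 ≤ b) (h0 : 0 < r) (h1 : r ≤ 1) :
    (mpow (A + B) (b + r)).trace ≤ (mpow (A + B) b * (mpow A r + mpow B r)).trace := by
  have hZ := hA.add hB
  rcases h1.eq_or_lt with rfl | h1
  · rw [mpow_one hA, mpow_one hB]
    nth_rewrite 3 [← mpow_one hZ]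
    rw [mpow, mpow, mpow, cfc_mul_cfc]
    refine (congrArg trace (cfc_congr_eigenvalues hZ.1 fun i => ?_)).le
    exact Real.rpow_add_of_nonneg (hZ.eigenvalues_nonneg i) hb zero_le_one
  -- the perturbed, positive definite inequality
  have key : ∀ ε : ℝ, 0 < ε →
      (cfc (fun x : ℝ => (x + 2 * ε) ^ (b + r)) (A + B)).trace ≤
        (cfc (fun x : ℝ => (x + 2 * ε) ^ b) (A + B) * cfc (fun x : ℝ => (x + ε) ^ r) A).trace +
        (cfc (fun x : ℝ => (x + 2 * ε) ^ b) (A + B) * cfc (fun x : ℝ => (x + ε) ^ r) B).trace := by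
    intro ε hε
    have hI : (ε • (1 : Matrix m m ℝ)).PosDef := PosDef.one.smul hε
    have hA' := hI.posSemidef_add hA
    have hB' := hI.posSemidef_add hB
    have hZ' := hA'.add hB'
    have e : A + ε • (1 : Matrix m m ℝ) + (B + ε • (1 : Matrix m m ℝ))
        = A + B + (2 * ε) • (1 : Matrix m m ℝ) := by
      rw [mul_smul, two_smul]; abel
    have hA1 := trace_mpow_mul_le_of_le hA' hZ' (by simpa using hB'.posSemidef) hb h0.le h1
    have hB1 := trace_mpow_mul_le_of_le hB' hZ' (by simpa using hA'.posSemidef) hb h0.le h1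
    have hsum : (mpow (A + ε • (1 : Matrix m m ℝ) + (B + ε • (1 : Matrix m m ℝ)))
          (b + (r - 1)) * (A + ε • (1 : Matrix m m ℝ) + (B + ε • (1 : Matrix m m ℝ)))).trace
        = (mpow (A + ε • (1 : Matrix m m ℝ) + (B + ε • (1 : Matrix m m ℝ))) (b + r)).trace := by
      conv_lhs => rw [← mpow_one hZ'.posSemidef, mpow_one hZ'.posSemidef]
      nth_rewrite 2 [← mpow_one hZ'.posSemidef]
      rw [mpow_mul_mpow hZ']
      congr 2; ring
    rw [Matrix.mul_add, trace_add] at hsum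
    rw [e] at hsum hA1 hB1
    simp only [mpow, cfc_add_smul_one hZ.1, cfc_add_smul_one hA.1, cfc_add_smul_one hB.1]
      at hsum hA1 hB1
    linarith
  obtain ⟨cA, hcA⟩ := exists_trace_cfc_mul_cfc hZ.1 hA.1
  obtain ⟨cB, hcB⟩ := exists_trace_cfc_mul_cfc hZ.1 hB.1
  simp only [trace_cfc hZ.1, hcA, hcB] at key
  rw [Matrix.mul_add, trace_add, mpow, mpow, mpow, mpow, trace_cfc hZ.1, hcA, hcB]
  have cont : ∀ (x k : ℝ) {s : ℝ}, 0 ≤ s → Continuous fun ε : ℝ => (x + k * ε) ^ s :=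
    fun x k s hs => (by fun_prop : Continuous fun ε : ℝ => x + k * ε).rpow_const
      fun _ => Or.inr hs
  have cont' : ∀ (x : ℝ), Continuous fun ε : ℝ => (x + ε) ^ r := fun x => by
    simpa using cont x 1 h0.le
  have cL : Continuous fun ε : ℝ => ∑ i, (hZ.1.eigenvalues i + 2 * ε) ^ (b + r) :=
    continuous_finsetSum _ fun i _ => cont _ _ (by linarith)
  have cR : ∀ (c : m → m → ℝ) (x : m → ℝ), Continuous fun ε : ℝ =>
      ∑ i, ∑ j, c i j * ((hZ.1.eigenvalues i + 2 * ε) ^ b * (x j + ε) ^ r) := fun c x =>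
    continuous_finsetSum _ fun i _ => continuous_finsetSum _ fun j _ =>
      continuous_const.mul ((cont _ _ hb).mul (cont' _))
  have tL := (cL.tendsto 0).mono_left (nhdsWithin_le_nhds (s := Set.Ioi 0))
  have tR := (((cR cA hA.1.eigenvalues).add (cR cB hB.1.eigenvalues)).tendsto 0).mono_left
    (nhdsWithin_le_nhds (s := Set.Ioi 0))
  simpa using le_of_tendsto_of_tendsto tL tR (eventually_mem_nhdsWithin.mono fun ε hε => key ε hε)

/-- Lower half of the comparison of traces: concave powers are subadditive. The weight
`(A + B) ^ (r (q - 1))` in `trace_mpow_add_le` is absorbed by Young's inequality in the eigenbasis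
of `A + B`. -/
theorem trace_mpow_add_le_trace_mpow {A B : Matrix m m ℝ} (hA : A.PosSemidef) (hB : B.PosSemidef)
    {r q : ℝ} (h0 : 0 < r) (h1 : r ≤ 1) (hq : 1 ≤ q) :
    (mpow (A + B) (r * q)).trace ≤ (mpow (mpow A r + mpow B r) q).trace := by
  have hZ := hA.add hB
  have hW := (posSemidef_mpow hA r).add (posSemidef_mpow hB r)
  have hK := trace_mpow_add_le hA hB (b := r * (q - 1)) (by nlinarith) h0 h1
  rw [show r * (q - 1) + r = r * q by ring] at hK
  obtain ⟨V, v1, v2, hV⟩ := exists_spectral hZ.1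
  have hP := sum_qform_rpow_le_trace hW v1 v2 hq
  set w := fun i => qform (mpow A r + mpow B r) (V i) with hw
  have hw0 : ∀ i, 0 ≤ w i := fun i => qform_nonneg hW _
  have hz0 := hZ.eigenvalues_nonneg
  have e : (mpow (A + B) (r * (q - 1)) * (mpow A r + mpow B r)).trace
      = ∑ i, hZ.1.eigenvalues i ^ (r * (q - 1)) * w i := by
    simp only [hw, qform_row]
    rw [mpow, hV, Matrix.mul_assoc, Matrix.mul_assoc, trace_mul_comm, Matrix.mul_assoc, trace]
    simp [diagonal_mul]
  rw [e] at hK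
  have hT : (mpow (A + B) (r * q)).trace = ∑ i, hZ.1.eigenvalues i ^ (r * q) := trace_cfc hZ.1 _
  -- Young's inequality, termwise
  have hY : ∀ i, hZ.1.eigenvalues i ^ (r * (q - 1)) * w i ≤
      (1 - 1 / q) * hZ.1.eigenvalues i ^ (r * q) + 1 / q * w i ^ q := by
    intro i
    have hq0 : 0 < q := by linarith
    have := Real.geom_mean_le_arith_mean2_weighted (w₁ := 1 - 1 / q) (w₂ := 1 / q)
      (sub_nonneg.2 ((div_le_one hq0).2 hq)) (by positivity)
      (Real.rpow_nonneg (hz0 i) (r * q)) (Real.rpow_nonneg (hw0 i) q) (by ring)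
    rw [← Real.rpow_mul (hz0 i), ← Real.rpow_mul (hw0 i)] at this
    rw [show r * q * (1 - 1 / q) = r * (q - 1) by field_simp,
      show q * (1 / q) = 1 by field_simp, Real.rpow_one] at this
    exact this
  have hS := Finset.sum_le_sum fun i (_ : i ∈ Finset.univ) => hY i
  rw [Finset.sum_add_distrib, ← Finset.mul_sum, ← Finset.mul_sum, ← hT] at hS
  have h2 : 1 / q * (mpow (A + B) (r * q)).trace ≤ 1 / q * ∑ i, w i ^ q := by linarith
  exact (le_of_mul_le_mul_left h2 (by positivity)).trans hP

theorem add_rpow_le_two_rpow_mul {x y r : ℝ} (hx : 0 ≤ x) (hy : 0 ≤ y) (h0 : 0 ≤ r) (h1 : r ≤ 1) :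
    x ^ r + y ^ r ≤ 2 ^ (1 - r) * (x + y) ^ r := by
  obtain ⟨-, hc⟩ := Real.concaveOn_rpow h0 h1
  have := hc (Set.mem_Ici.2 hx) (Set.mem_Ici.2 hy) (a := 1 / 2) (b := 1 / 2)
    (by norm_num) (by norm_num) (by norm_num)
  simp only [smul_eq_mul] at this
  rw [← mul_add, ← mul_add, Real.mul_rpow (by norm_num) (by positivity)] at this
  rw [Real.rpow_sub two_pos, Real.rpow_one]
  rw [Real.div_rpow (by norm_num) (by norm_num), Real.one_rpow] at this
  calc x ^ r + y ^ r = 2 * (1 / 2 * (x ^ r + y ^ r)) := by ring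
    _ ≤ 2 * (1 / 2 ^ r * (x + y) ^ r) := by linarith
    _ = _ := by ring

/-- In a vector state, the concave powers of two positive semidefinite matrices are controlled by
the power of the sum of the expectations. -/
theorem qform_mpow_add_mpow_le {A B : Matrix m m ℝ} (hA : A.PosSemidef) (hB : B.PosSemidef)
    {e : m → ℝ} (he : e ⬝ᵥ e = 1) {r : ℝ} (h0 : 0 ≤ r) (h1 : r ≤ 1) :
    qform (mpow A r + mpow B r) e ≤ 2 ^ (1 - r) * qform (A + B) e ^ r := by
  rw [qform_add, qform_add]
  exact (add_le_add (qform_mpow_le hA he h0 h1) (qform_mpow_le hB he h0 h1)).trans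
    (add_rpow_le_two_rpow_mul (qform_nonneg hA e) (qform_nonneg hB e) h0 h1)

/-- Upper half of the comparison of traces: concave powers are midpoint concave. The argument runs
in the eigenbasis of `A ^ r + B ^ r`. -/
theorem trace_mpow_le_trace_mpow_add {A B : Matrix m m ℝ} (hA : A.PosSemidef) (hB : B.PosSemidef)
    {r q : ℝ} (h0 : 0 < r) (h1 : r ≤ 1) (hq : 0 ≤ q) (hrq : 1 ≤ r * q) :
    (mpow (mpow A r + mpow B r) q).trace ≤
      (2 ^ (1 - r)) ^ q * (mpow (A + B) (r * q)).trace := by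
  have hZ := hA.add hB
  have hW := (posSemidef_mpow hA r).add (posSemidef_mpow hB r)
  obtain ⟨V, v1, v2, hV⟩ := exists_eigenrows hW.1
  have hid : ∀ i, qform (mpow A r + mpow B r) (V i) = hW.1.eigenvalues i := fun i => by
    simpa [cfc_id_matrix hW.1] using hV (fun x => x) i
  have hT : (mpow (mpow A r + mpow B r) q).trace = ∑ i, qform (mpow A r + mpow B r) (V i) ^ q := by
    simp only [hid]; exact trace_cfc hW.1 _
  rw [hT]
  refine le_trans ?_ (mul_le_mul_of_nonneg_left (sum_qform_rpow_le_trace hZ v1 v2 hrq)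
    (by positivity))
  rw [Finset.mul_sum]
  refine Finset.sum_le_sum fun i _ => ?_
  have hZi := qform_nonneg hZ (V i)
  rw [Real.rpow_mul hZi, ← Real.mul_rpow (by positivity) (by positivity)]
  exact Real.rpow_le_rpow (qform_nonneg hW _)
    (qform_mpow_add_mpow_le hA hB (row_dotProduct_self v1 i) h0.le h1) hq

/-! ### Schatten norms -/

/-- The Schatten `q`-norm `(tr M ^ q) ^ (1 / q)` of a positive semidefinite matrix, which is its own
absolute value. -/
noncomputable def schatten (q : ℝ) (M : Matrix m m ℝ) : ℝ := (mpow M q).trace ^ (1 / q)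

theorem trace_mpow_nonneg {M : Matrix m m ℝ} (hM : M.PosSemidef) (q : ℝ) :
    0 ≤ (mpow M q).trace := (posSemidef_mpow hM q).trace_nonneg

/-- Triangle inequality for the Schatten `2p`-norm of the stacked matrix `[A; B]`: Minkowski's
inequality for the lengths of the images of an eigenbasis of the left-hand Gram matrix, and
Peierls' inequality on the right. -/
theorem schatten_triangle (A₁ A₂ B₁ B₂ : Matrix m m ℝ) {p : ℝ} (hp : 1 ≤ p) :
    schatten p ((A₁ + A₂)ᵀ * (A₁ + A₂) + (B₁ + B₂)ᵀ * (B₁ + B₂)) ^ (1 / 2 : ℝ) ≤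
      schatten p (A₁ᵀ * A₁ + B₁ᵀ * B₁) ^ (1 / 2 : ℝ) +
      schatten p (A₂ᵀ * A₂ + B₂ᵀ * B₂) ^ (1 / 2 : ℝ) := by
  have hs : ∀ A B : Matrix m m ℝ, schatten p (Aᵀ * A + Bᵀ * B) ^ (1 / 2 : ℝ)
      = (mpow (Aᵀ * A + Bᵀ * B) p).trace ^ (1 / (2 * p)) := fun A B => by
    rw [schatten, ← Real.rpow_mul (trace_mpow_nonneg (posSemidef_gram_add A B) p)]
    congr 1; ring
  have hT := posSemidef_gram_add (A₁ + A₂) (B₁ + B₂)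
  obtain ⟨V, v1, v2, hV⟩ := exists_eigenrows hT.1
  -- the length of the image of the `i`-th eigenvector under `[A; B]`
  set l : Matrix m m ℝ → Matrix m m ℝ → m → ℝ :=
    fun A B i => qform (Aᵀ * A + Bᵀ * B) (V i) ^ (1 / 2 : ℝ) with hl
  have hl0 : ∀ A B i, 0 ≤ l A B i := fun A B i =>
    Real.rpow_nonneg (qform_nonneg (posSemidef_gram_add A B) _) _
  have hpow : ∀ A B i, l A B i ^ (2 * p) = qform (Aᵀ * A + Bᵀ * B) (V i) ^ p := fun A B i => by
    rw [hl, ← Real.rpow_mul (qform_nonneg (posSemidef_gram_add A B) _)]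
    congr 1; ring
  have hid : ∀ i, qform ((A₁ + A₂)ᵀ * (A₁ + A₂) + (B₁ + B₂)ᵀ * (B₁ + B₂)) (V i)
      = hT.1.eigenvalues i := fun i => by
    simpa only [cfc_id_matrix hT.1] using hV (fun x => x) i
  have hL : (mpow ((A₁ + A₂)ᵀ * (A₁ + A₂) + (B₁ + B₂)ᵀ * (B₁ + B₂)) p).trace
      = ∑ i, l (A₁ + A₂) (B₁ + B₂) i ^ (2 * p) := by
    simp only [hpow, hid]; exact trace_cfc hT.1 _
  have hR : ∀ A B, ∑ i, l A B i ^ (2 * p) ≤ (mpow (Aᵀ * A + Bᵀ * B) p).trace := fun A B => by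
    simp only [hpow]
    exact sum_qform_rpow_le_trace (posSemidef_gram_add A B) v1 v2 hp
  have hp0 : (0 : ℝ) ≤ 1 / (2 * p) := by positivity
  have hsum : ∀ A B, 0 ≤ ∑ i, l A B i ^ (2 * p) := fun A B =>
    Finset.sum_nonneg fun i _ => Real.rpow_nonneg (hl0 A B i) _
  rw [hs, hs, hs, hL]
  calc (∑ i, l (A₁ + A₂) (B₁ + B₂) i ^ (2 * p)) ^ (1 / (2 * p))
      ≤ (∑ i, (l A₁ B₁ i + l A₂ B₂ i) ^ (2 * p)) ^ (1 / (2 * p)) := by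
        refine Real.rpow_le_rpow (hsum _ _) (Finset.sum_le_sum fun i _ => ?_) hp0
        exact Real.rpow_le_rpow (hl0 _ _ i) (sqrt_qform_triangle _ _ _ _ _) (by linarith)
    _ ≤ (∑ i, l A₁ B₁ i ^ (2 * p)) ^ (1 / (2 * p)) +
        (∑ i, l A₂ B₂ i ^ (2 * p)) ^ (1 / (2 * p)) :=
        Real.Lp_add_le_of_nonneg _ (by linarith) (fun i _ => hl0 _ _ i) (fun i _ => hl0 _ _ i)
    _ ≤ _ := add_le_add (Real.rpow_le_rpow (hsum _ _) (hR _ _) hp0)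
        (Real.rpow_le_rpow (hsum _ _) (hR _ _) hp0)

/-! ### Comparison of gauges -/

/-- The gauges `g` and `h` compare the power of a sum with the sum of the powers, up to the
constant `2 ^ (1 - r)`. -/
def PowerComparison (g h : Matrix m m ℝ → ℝ) (r : ℝ) : Prop :=
  ∀ A B : Matrix m m ℝ, A.PosSemidef → B.PosSemidef →
    h (A + B) ^ r ≤ g (mpow A r + mpow B r) ∧
      g (mpow A r + mpow B r) ≤ 2 ^ (1 - r) * h (A + B) ^ r

theorem schatten_nonneg {M : Matrix m m ℝ} (hM : M.PosSemidef) (q : ℝ) : 0 ≤ schatten q M :=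
  Real.rpow_nonneg (trace_mpow_nonneg hM q) _

theorem powerComparison_schatten {r q : ℝ} (h0 : 0 < r) (h1 : r ≤ 1) (hq : 1 ≤ q)
    (hrq : 1 ≤ r * q) : PowerComparison (m := m) (schatten q) (schatten (r * q)) r := by
  intro A B hA hB
  have hT := trace_mpow_nonneg (hA.add hB) (r * q)
  have e : schatten (r * q) (A + B) ^ r = (mpow (A + B) (r * q)).trace ^ (1 / q) := by
    rw [schatten, ← Real.rpow_mul hT]; congr 1; field_simp
  have hW := trace_mpow_nonneg ((posSemidef_mpow hA r).add (posSemidef_mpow hB r)) q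
  rw [e, schatten]
  refine ⟨Real.rpow_le_rpow hT (trace_mpow_add_le_trace_mpow hA hB h0 h1 hq) (by positivity), ?_⟩
  refine (Real.rpow_le_rpow hW (trace_mpow_le_trace_mpow_add hA hB h0 h1 (by linarith) hrq)
    (by positivity)).trans_eq ?_
  rw [Real.mul_rpow (by positivity) hT, ← Real.rpow_mul (by positivity),
    mul_one_div_cancel (by linarith), Real.rpow_one]

/-- The Minkowski inequality for a gauge `g`, by comparison with a gauge `h` such that the square
root of `h` at the Gram matrix of a stacked matrix `[A; B]` obeys the triangle inequality. -/
theorem minkowski_of_powerComparison {g h : Matrix m m ℝ → ℝ} {p : ℝ} (hp : 1 ≤ p)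
    (hg : ∀ M : Matrix m m ℝ, M.PosSemidef → 0 ≤ g M)
    (hh : ∀ M : Matrix m m ℝ, M.PosSemidef → 0 ≤ h M)
    (hle : p ≤ 2 → PowerComparison g h (p / 2))
    (hge : 2 ≤ p → PowerComparison h g (2 / p))
    (htri : ∀ A₁ A₂ B₁ B₂ : Matrix m m ℝ,
      h ((A₁ + A₂)ᵀ * (A₁ + A₂) + (B₁ + B₂)ᵀ * (B₁ + B₂)) ^ (1 / 2 : ℝ) ≤
      h (A₁ᵀ * A₁ + B₁ᵀ * B₁) ^ (1 / 2 : ℝ) + h (A₂ᵀ * A₂ + B₂ᵀ * B₂) ^ (1 / 2 : ℝ))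
    (A₁ A₂ B₁ B₂ : Matrix m m ℝ) :
    (2 : ℝ) ^ (-|1 / p - 1 / 2|) * g (mpow ((A₁ + A₂)ᵀ * (A₁ + A₂)) (p / 2) +
        mpow ((B₁ + B₂)ᵀ * (B₁ + B₂)) (p / 2)) ^ (1 / p) ≤
      g (mpow (A₁ᵀ * A₁) (p / 2) + mpow (B₁ᵀ * B₁) (p / 2)) ^ (1 / p) +
      g (mpow (A₂ᵀ * A₂) (p / 2) + mpow (B₂ᵀ * B₂) (p / 2)) ^ (1 / p) := by
  have hp0 : 0 < p := by linarith
  have hgram : ∀ A : Matrix m m ℝ, (Aᵀ * A).PosSemidef := posSemidef_gram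
  have hc : (0 : ℝ) < 2 ^ |1 / p - 1 / 2| := by positivity
  rw [Real.rpow_neg two_pos.le, inv_mul_le_iff₀ hc]
  have hgs : ∀ A B : Matrix m m ℝ, 0 ≤ g (mpow (Aᵀ * A) (p / 2) + mpow (Bᵀ * B) (p / 2)) :=
    fun A B => hg _ ((posSemidef_mpow (hgram A) _).add (posSemidef_mpow (hgram B) _))
  have hhs : ∀ A B : Matrix m m ℝ, 0 ≤ h (Aᵀ * A + Bᵀ * B) :=
    fun A B => hh _ (posSemidef_gram_add A B)
  rcases le_total p 2 with h2 | h2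
  · have hcmp : ∀ A B : Matrix m m ℝ,
        h (Aᵀ * A + Bᵀ * B) ^ (1 / 2 : ℝ) ≤
          g (mpow (Aᵀ * A) (p / 2) + mpow (Bᵀ * B) (p / 2)) ^ (1 / p) ∧
        g (mpow (Aᵀ * A) (p / 2) + mpow (Bᵀ * B) (p / 2)) ^ (1 / p) ≤
          2 ^ |1 / p - 1 / 2| * h (Aᵀ * A + Bᵀ * B) ^ (1 / 2 : ℝ) := by
      intro A B
      obtain ⟨l, u⟩ := hle h2 _ _ (hgram A) (hgram B)
      have e : (h (Aᵀ * A + Bᵀ * B) ^ (p / 2)) ^ (1 / p) = h (Aᵀ * A + Bᵀ * B) ^ (1 / 2 : ℝ) := by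
        rw [← Real.rpow_mul (hhs A B)]; congr 1; field_simp
      have hinv : 1 / 2 ≤ 1 / p := one_div_le_one_div_of_le hp0 h2
      refine ⟨e ▸ Real.rpow_le_rpow (Real.rpow_nonneg (hhs A B) _) l (by positivity), ?_⟩
      refine (Real.rpow_le_rpow (hgs A B) u (by positivity)).trans_eq ?_
      rw [Real.mul_rpow (by positivity) (Real.rpow_nonneg (hhs A B) _), e,
        ← Real.rpow_mul two_pos.le, abs_of_nonneg (by linarith)]
      congr 2; field_simp
    calc _ ≤ 2 ^ |1 / p - 1 / 2| * _ := (hcmp _ _).2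
      _ ≤ _ := mul_le_mul_of_nonneg_left ((htri A₁ A₂ B₁ B₂).trans
          (add_le_add (hcmp _ _).1 (hcmp _ _).1)) hc.le
  · have hcmp : ∀ A B : Matrix m m ℝ,
        g (mpow (Aᵀ * A) (p / 2) + mpow (Bᵀ * B) (p / 2)) ^ (1 / p) ≤
          h (Aᵀ * A + Bᵀ * B) ^ (1 / 2 : ℝ) ∧
        h (Aᵀ * A + Bᵀ * B) ^ (1 / 2 : ℝ) ≤ 2 ^ |1 / p - 1 / 2| *
          g (mpow (Aᵀ * A) (p / 2) + mpow (Bᵀ * B) (p / 2)) ^ (1 / p) := by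
      intro A B
      obtain ⟨l, u⟩ := hge h2 _ _ (posSemidef_mpow (hgram A) (p / 2))
        (posSemidef_mpow (hgram B) (p / 2))
      -- the comparison is applied to the powers `p / 2`, whose powers `2 / p` are the Gram matrices
      have hp' : p / 2 * (2 / p) = 1 := by field_simp
      rw [mpow_mpow (hgram A), mpow_mpow (hgram B), hp', mpow_one (hgram A),
        mpow_one (hgram B)] at l u
      have e : (g (mpow (Aᵀ * A) (p / 2) + mpow (Bᵀ * B) (p / 2)) ^ (2 / p)) ^ (1 / 2 : ℝ) =
          g (mpow (Aᵀ * A) (p / 2) + mpow (Bᵀ * B) (p / 2)) ^ (1 / p) := by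
        rw [← Real.rpow_mul (hgs A B)]; congr 1; field_simp
      have hinv : 1 / p ≤ 1 / 2 := one_div_le_one_div_of_le two_pos h2
      refine ⟨e ▸ Real.rpow_le_rpow (Real.rpow_nonneg (hgs A B) _) l (by positivity), ?_⟩
      refine (Real.rpow_le_rpow (hhs A B) u (by positivity)).trans_eq ?_
      rw [Real.mul_rpow (by positivity) (Real.rpow_nonneg (hgs A B) _), e,
        ← Real.rpow_mul two_pos.le, abs_of_nonpos (by linarith)]
      congr 2; ring
    calc _ ≤ _ := (hcmp _ _).1
      _ ≤ _ := htri A₁ A₂ B₁ B₂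
      _ ≤ _ := by rw [mul_add]; exact add_le_add (hcmp _ _).2 (hcmp _ _).2

theorem mpow_two {M : Matrix m m ℝ} (hM : M.IsHermitian) :
    mpow M 2 = M * M := by
  conv_rhs => rw [← cfc_id_matrix hM]
  rw [cfc_mul_cfc, mpow]
  simp [sq]

theorem schatten_two_eq_sqrt (M : Matrix m m ℝ) :
    schatten 2 M = √(mpow M 2).trace := by
  rw [schatten, Real.sqrt_eq_rpow]

/-! ### The operator norm -/

section OperatorNorm

open scoped Matrix.Norms.L2Operator

theorem norm_cfc {M : Matrix m m ℝ} (hM : M.IsHermitian) (f : ℝ → ℝ) :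
    ‖cfc f M‖ = ‖fun i => f (hM.eigenvalues i)‖ := by
  obtain ⟨W, h1, h2, h⟩ := exists_spectral hM
  have hW : W ∈ unitary (Matrix m m ℝ) := Unitary.mem_iff.2 ⟨by simpa using! h2, by simpa using! h1⟩
  have hW' : Wᵀ ∈ unitary (Matrix m m ℝ) :=
    Unitary.mem_iff.2 ⟨by simpa using! h1, by simpa using! h2⟩
  rw [h, CStarRing.norm_mul_mem_unitary _ hW, CStarRing.norm_mem_unitary_mul _ hW',
    l2_opNorm_diagonal]

theorem eigenvalues_le_norm {M : Matrix m m ℝ} (hM : M.IsHermitian) (i : m) :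
    hM.eigenvalues i ≤ ‖M‖ := by
  have h := norm_cfc hM fun x => x
  rw [cfc_id_matrix hM] at h
  rw [h]
  exact (le_abs_self _).trans (norm_le_pi_norm (fun i => hM.eigenvalues i) i)

theorem qform_le_norm {M : Matrix m m ℝ} (hM : M.IsHermitian) {e : m → ℝ} (he : e ⬝ᵥ e = 1) :
    qform M e ≤ ‖M‖ := by
  obtain ⟨c, hc0, hc1, hc⟩ := exists_qform_cfc hM he
  rw [qform_eq_sum hM hc]
  calc _ ≤ ∑ j, c j * ‖M‖ := Finset.sum_le_sum fun j _ =>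
        mul_le_mul_of_nonneg_left (eigenvalues_le_norm hM j) (hc0 j)
    _ = _ := by rw [← Finset.sum_mul, hc1, one_mul]

theorem norm_le_of_qform_le {M : Matrix m m ℝ} (hM : M.PosSemidef) {c : ℝ} (hc : 0 ≤ c)
    (h : ∀ e : m → ℝ, e ⬝ᵥ e = 1 → qform M e ≤ c) : ‖M‖ ≤ c := by
  obtain ⟨W, h1, -, hW⟩ := exists_eigenrows hM.1
  have hn := norm_cfc hM.1 fun x => x
  rw [cfc_id_matrix hM.1] at hn
  rw [hn, pi_norm_le_iff_of_nonneg hc]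
  intro i
  have := hW (fun x => x) i
  rw [cfc_id_matrix hM.1] at this
  rw [Real.norm_of_nonneg (hM.eigenvalues_nonneg i), ← this]
  exact h _ (row_dotProduct_self h1 i)

theorem norm_mpow_le {M : Matrix m m ℝ} (hM : M.PosSemidef) {s : ℝ} (hs : 0 ≤ s) :
    ‖mpow M s‖ ≤ ‖M‖ ^ s := by
  rw [mpow, norm_cfc hM.1, pi_norm_le_iff_of_nonneg (by positivity)]
  intro i
  rw [Real.norm_of_nonneg (Real.rpow_nonneg (hM.eigenvalues_nonneg i) _)]
  exact Real.rpow_le_rpow (hM.eigenvalues_nonneg i) (eigenvalues_le_norm hM.1 i) hs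

theorem norm_mpow {M : Matrix m m ℝ} (hM : M.PosSemidef) {s : ℝ} (hs : 0 < s) :
    ‖mpow M s‖ = ‖M‖ ^ s := by
  refine (norm_mpow_le hM hs.le).antisymm ?_
  have := norm_mpow_le (posSemidef_mpow hM s) (s := 1 / s) (by positivity)
  rw [mpow_mpow hM, mul_one_div_cancel hs.ne', mpow_one hM] at this
  calc ‖M‖ ^ s ≤ (‖mpow M s‖ ^ (1 / s)) ^ s := Real.rpow_le_rpow (norm_nonneg _) this hs.le
    _ = _ := by rw [← Real.rpow_mul (norm_nonneg _), one_div_mul_cancel hs.ne', Real.rpow_one]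

theorem norm_le_norm_add {A B : Matrix m m ℝ} (hA : A.PosSemidef) (hB : B.PosSemidef) :
    ‖A‖ ≤ ‖A + B‖ :=
  norm_le_of_qform_le hA (norm_nonneg _) fun e he =>
    (le_add_of_nonneg_right (qform_nonneg hB e)).trans
      ((qform_add A B e).symm.trans_le (qform_le_norm (hA.add hB).1 he))

/-- If `A ^ r ≤ c` then `A ≤ c ^ ((1 - r) / r) A ^ r`, since `A = (A ^ r) ^ ((1 - r) / r) A ^ r`. -/
theorem qform_le_mul_qform_mpow {A : Matrix m m ℝ} (hA : A.PosSemidef) {e : m → ℝ}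
    (he : e ⬝ᵥ e = 1) {r c : ℝ} (h0 : 0 < r) (h1 : r ≤ 1) (hc : ‖mpow A r‖ ≤ c) :
    qform A e ≤ c ^ ((1 - r) / r) * qform (mpow A r) e := by
  obtain ⟨w, hw0, -, hw⟩ := exists_qform_cfc hA.1 he
  rw [qform_eq_sum hA.1 hw, mpow, hw, Finset.mul_sum]
  refine Finset.sum_le_sum fun j _ => ?_
  have ha := hA.eigenvalues_nonneg j
  have hr : hA.1.eigenvalues j ^ r ≤ c := by
    rw [mpow, norm_cfc hA.1] at hc
    exact (le_abs_self _).trans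
      ((norm_le_pi_norm (fun i => hA.1.eigenvalues i ^ r) j).trans hc)
  have hle : hA.1.eigenvalues j ≤ c ^ ((1 - r) / r) * hA.1.eigenvalues j ^ r := by
    calc hA.1.eigenvalues j
        = (hA.1.eigenvalues j ^ r) ^ ((1 - r) / r) * hA.1.eigenvalues j ^ r := by
          rw [← Real.rpow_mul ha, mul_div_cancel₀ _ h0.ne',
            ← Real.rpow_add_of_nonneg ha (by linarith) h0.le]
          simp
      _ ≤ _ := mul_le_mul_of_nonneg_right (Real.rpow_le_rpow (Real.rpow_nonneg ha _) hr
          (div_nonneg (by linarith) h0.le)) (Real.rpow_nonneg ha _)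
  calc _ ≤ w j * (c ^ ((1 - r) / r) * hA.1.eigenvalues j ^ r) :=
        mul_le_mul_of_nonneg_left hle (hw0 j)
    _ = _ := by ring

theorem powerComparison_norm {r : ℝ} (h0 : 0 < r) (h1 : r ≤ 1) :
    PowerComparison (m := m) (fun M => ‖M‖) (fun M => ‖M‖) r := by
  intro A B hA hB
  have hAr := posSemidef_mpow hA r
  have hBr := posSemidef_mpow hB r
  set c := ‖mpow A r + mpow B r‖ with hc
  have hc0 : 0 ≤ c := norm_nonneg _
  constructor
  · have key : ‖A + B‖ ≤ c ^ (1 / r) := by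
      refine norm_le_of_qform_le (hA.add hB) (by positivity) fun e he => ?_
      have a := qform_le_mul_qform_mpow hA he h0 h1 (norm_le_norm_add hAr hBr)
      have b := qform_le_mul_qform_mpow hB he h0 h1
        ((norm_le_norm_add hBr hAr).trans_eq (congrArg norm (add_comm _ _)))
      calc qform (A + B) e = qform A e + qform B e := qform_add A B e
        _ ≤ c ^ ((1 - r) / r) * qform (mpow A r + mpow B r) e := by
          rw [qform_add, mul_add]; exact add_le_add a b
        _ ≤ c ^ ((1 - r) / r) * c := by
          refine mul_le_mul_of_nonneg_left (qform_le_norm (hAr.add hBr).1 he) (by positivity)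
        _ = c ^ ((1 - r) / r) * c ^ (1 : ℝ) := by rw [Real.rpow_one]
        _ = c ^ (1 / r) := by
          rw [← Real.rpow_add_of_nonneg hc0 (div_nonneg (by linarith) h0.le) zero_le_one]
          congr 1; field_simp; ring
    calc ‖A + B‖ ^ r ≤ (c ^ (1 / r)) ^ r := Real.rpow_le_rpow (norm_nonneg _) key h0.le
      _ = c := by rw [← Real.rpow_mul hc0, one_div_mul_cancel h0.ne', Real.rpow_one]
  · refine norm_le_of_qform_le (hAr.add hBr) (by positivity) fun e he => ?_
    refine (qform_mpow_add_mpow_le hA hB he h0.le h1).trans ?_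
    exact mul_le_mul_of_nonneg_left (Real.rpow_le_rpow (qform_nonneg (hA.add hB) e)
      (qform_le_norm (hA.add hB).1 he) h0.le) (by positivity)

/-- Triangle inequality for the operator norm of the stacked matrix `[A; B]`. -/
theorem norm_gram_triangle (A₁ A₂ B₁ B₂ : Matrix m m ℝ) :
    ‖(A₁ + A₂)ᵀ * (A₁ + A₂) + (B₁ + B₂)ᵀ * (B₁ + B₂)‖ ^ (1 / 2 : ℝ) ≤
      ‖A₁ᵀ * A₁ + B₁ᵀ * B₁‖ ^ (1 / 2 : ℝ) + ‖A₂ᵀ * A₂ + B₂ᵀ * B₂‖ ^ (1 / 2 : ℝ) := by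
  set c := ‖A₁ᵀ * A₁ + B₁ᵀ * B₁‖ ^ (1 / 2 : ℝ) + ‖A₂ᵀ * A₂ + B₂ᵀ * B₂‖ ^ (1 / 2 : ℝ) with hc
  have hc0 : 0 ≤ c := by positivity
  have sq_half : ∀ x : ℝ, 0 ≤ x → (x ^ (1 / 2 : ℝ)) ^ 2 = x := fun x hx => by
    rw [← Real.sqrt_eq_rpow, Real.sq_sqrt hx]
  have key : ‖(A₁ + A₂)ᵀ * (A₁ + A₂) + (B₁ + B₂)ᵀ * (B₁ + B₂)‖ ≤ c ^ 2 := by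
    refine norm_le_of_qform_le (posSemidef_gram_add _ _) (by positivity) fun e he => ?_
    have hn := qform_nonneg (posSemidef_gram_add (A₁ + A₂) (B₁ + B₂)) e
    rw [← sq_half _ hn]
    refine pow_le_pow_left₀ (by positivity) ((sqrt_qform_triangle A₁ A₂ B₁ B₂ e).trans ?_) 2
    exact add_le_add
      (Real.rpow_le_rpow (qform_nonneg (posSemidef_gram_add _ _) e)
        (qform_le_norm (posSemidef_gram_add _ _).1 he) (by norm_num))
      (Real.rpow_le_rpow (qform_nonneg (posSemidef_gram_add _ _) e)
        (qform_le_norm (posSemidef_gram_add _ _).1 he) (by norm_num))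
  rw [← Real.sqrt_eq_rpow]
  exact Real.sqrt_le_iff.2 ⟨hc0, key⟩

theorem norm_le_schatten_two {M : Matrix m m ℝ}
    (hM : M.PosSemidef) : ‖M‖ ≤ schatten 2 M := by
  have h := norm_cfc hM.1 fun x => x
  rw [cfc_id_matrix hM.1] at h
  rw [h, schatten_two_eq_sqrt, mpow, trace_cfc hM.1, pi_norm_le_iff_of_nonneg (Real.sqrt_nonneg _)]
  intro i
  refine Real.abs_le_sqrt ?_
  simp only [Real.rpow_two]
  exact Finset.single_le_sum (f := fun i => hM.1.eigenvalues i ^ 2) (fun i _ => sq_nonneg _)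
    (Finset.mem_univ i)

theorem schatten_two_le {M : Matrix m m ℝ}
    (hM : M.PosSemidef) : schatten 2 M ≤ √(Fintype.card m) * ‖M‖ := by
  rw [schatten_two_eq_sqrt, mpow, trace_cfc hM.1]
  refine Real.sqrt_le_iff.2 ⟨by positivity, ?_⟩
  rw [mul_pow, Real.sq_sqrt (by positivity)]
  simp only [Real.rpow_two]
  calc _ ≤ ∑ _i : m, ‖M‖ ^ 2 := Finset.sum_le_sum fun i _ =>
        pow_le_pow_left₀ (hM.eigenvalues_nonneg i) (eigenvalues_le_norm hM.1 i) 2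
    _ = _ := by simp

end OperatorNorm

end RealMatrices

/-! ### Block circulant matrices -/

section BlockCirculant

variable {n n₃ : ℕ} [NeZero n₃]

theorem bcirc_add (A B : Tensor n n n₃) : bcirc (A + B) = bcirc A + bcirc B := rfl

theorem bcirc_tTranspose (A : Tensor n n n₃) : bcirc (tTranspose A) = (bcirc A)ᵀ := by
  ext ⟨k, i⟩ ⟨l, j⟩
  simp [bcirc, tTranspose]

/-- The permutation matrix of the cyclic shift of block indices by `c`. -/
def blockShift (c : Fin n₃) : Matrix (Fin n₃ × Fin n) (Fin n₃ × Fin n) ℝ :=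
  ((Equiv.addRight c).prodCongr (Equiv.refl (Fin n))).toPEquiv.toMatrix

theorem commute_blockShift_iff {M : Matrix (Fin n₃ × Fin n) (Fin n₃ × Fin n) ℝ} {c : Fin n₃} :
    Commute M (blockShift c) ↔ ∀ k i l j, M (k + c, i) (l + c, j) = M (k, i) (l, j) := by
  rw [Commute, SemiconjBy, blockShift, PEquiv.toMatrix_toPEquiv_mul, PEquiv.mul_toMatrix_toPEquiv]
  constructor
  · intro h k i l j
    have := congrFun (congrFun h (k, i)) (l + c, j)
    simpa using this.symm
  · intro h
    ext ⟨k, i⟩ ⟨l, j⟩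
    have := h k i (l - c) j
    rw [sub_add_cancel] at this
    simpa [sub_eq_add_neg] using this.symm

theorem commute_bcirc_blockShift (A : Tensor n n n₃) (c : Fin n₃) :
    Commute (bcirc A) (blockShift c) := by
  rw [commute_blockShift_iff]
  intro k i l j
  simp [bcirc]

/-- A matrix that commutes with the block shifts is the block circulant matrix of its first block
column. -/
theorem bcirc_fold_of_commute {M : Matrix (Fin n₃ × Fin n) (Fin n₃ × Fin n) ℝ}
    (hM : ∀ c, Commute M (blockShift c)) : bcirc (fold (M * unfold (tOne n n₃))) = M := by
  have hcol : ∀ k i j, (M * unfold (tOne n n₃)) (k, i) j = M (k, i) (0, j) := by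
    intro k i j
    rw [mul_apply, Fintype.sum_prod_type, Finset.sum_eq_single 0, Finset.sum_eq_single j]
    · simp [unfold, tOne]
    · intro b _ hb; simp [unfold, tOne, one_apply, hb]
    · simp
    · intro b _ hb; simp [unfold, tOne, hb]
    · simp
  ext ⟨k, i⟩ ⟨l, j⟩
  have := commute_blockShift_iff.1 (hM l) (k - l) i 0 j
  rw [sub_add_cancel, zero_add] at this
  simpa [bcirc, fold, hcol] using this.symm

theorem bcirc_mul_unfold_tOne (A : Tensor n n n₃) : bcirc A * unfold (tOne n n₃) = unfold A := by
  have h := bcirc_fold_of_commute (commute_bcirc_blockShift A)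
  ext ⟨k, i⟩ j
  have := congrFun (congrFun h (k, i)) (0, j)
  simpa [bcirc, fold, unfold] using this

theorem bcirc_tProd (A B : Tensor n n n₃) : bcirc (tProd A B) = bcirc A * bcirc B := by
  rw [tProd, ← bcirc_mul_unfold_tOne B, ← Matrix.mul_assoc]
  exact bcirc_fold_of_commute fun c =>
    (commute_bcirc_blockShift A c).mul_left (commute_bcirc_blockShift B c)

/-- Functions of `bcirc 𝒜` are again block circulant, because they commute with whatever commutes
with `bcirc 𝒜`. -/
theorem bcirc_tFun (f : ℝ → ℝ) (A : Tensor n n n₃) : bcirc (tFun f A) = cfc f (bcirc A) :=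
  bcirc_fold_of_commute fun c => (commute_bcirc_blockShift A c).cfc_real f

theorem bcirc_tPow_tAbs (A : Tensor n n n₃) (r : ℝ) :
    bcirc (tPow (tAbs A) r) = mpow ((bcirc A)ᵀ * bcirc A) (r / 2) := by
  have hX := posSemidef_gram (bcirc A)
  have h : bcirc (tAbs A) = mpow ((bcirc A)ᵀ * bcirc A) (1 / 2) := by
    rw [tAbs, tPow, bcirc_tFun, bcirc_tProd, bcirc_tTranspose, mpow]
  have h2 : bcirc (tPow (tAbs A) r) = mpow (bcirc (tAbs A)) r := bcirc_tFun _ _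
  rw [h2, h, mpow_mpow hX]
  congr 1; ring

/-- `|𝒜| ^ r + |ℬ| ^ r` in block circulant form. -/
noncomputable def powSum (r : ℝ) (A B : Tensor n n n₃) :
    Matrix (Fin n₃ × Fin n) (Fin n₃ × Fin n) ℝ :=
  mpow ((bcirc A)ᵀ * bcirc A) (r / 2) + mpow ((bcirc B)ᵀ * bcirc B) (r / 2)

theorem posSemidef_powSum (r : ℝ) (A B : Tensor n n n₃) : (powSum r A B).PosSemidef :=
  (posSemidef_mpow (posSemidef_gram _) _).add (posSemidef_mpow (posSemidef_gram _) _)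

theorem bcirc_tPow_add_tPow (r : ℝ) (A B : Tensor n n n₃) :
    bcirc (tPow (tAbs A) r + tPow (tAbs B) r) = powSum r A B := by
  rw [bcirc_add, bcirc_tPow_tAbs, bcirc_tPow_tAbs, powSum]

/-- Every entry of a tensor occurs `n₃` times in its block circulant matrix. -/
theorem frobNorm_eq {T : Tensor n n n₃} (hT : (bcirc T).IsHermitian) :
    frobNorm T = (√n₃)⁻¹ * schatten 2 (bcirc T) := by
  have hn : (0 : ℝ) < n₃ := Nat.cast_pos.2 (NeZero.pos n₃)
  have htr : (mpow (bcirc T) 2).trace = n₃ * ∑ i, ∑ j, ∑ k, |T k i j| ^ 2 := by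
    rw [mpow_two hT]
    conv_lhs => enter [1, 1]; rw [← hT.eq]
    calc _ = ∑ l : Fin n₃, ∑ j, ∑ k : Fin n₃, ∑ i, T (k - l) i j ^ 2 := by
          simp [trace, mul_apply, Fintype.sum_prod_type, bcirc, sq]
      _ = ∑ l : Fin n₃, ∑ j, ∑ k : Fin n₃, ∑ i, T k i j ^ 2 := by
          refine Finset.sum_congr rfl fun l _ => Finset.sum_congr rfl fun j _ => ?_
          exact (Equiv.subRight l).sum_comp fun k => ∑ i, T k i j ^ 2
      _ = n₃ * ∑ j, ∑ k : Fin n₃, ∑ i, T k i j ^ 2 := by simp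
      _ = _ := by
          congr 1
          simp only [sq_abs]
          rw [Finset.sum_comm (s := (Finset.univ : Finset (Fin n)))
            (t := (Finset.univ : Finset (Fin n)))]
          exact Finset.sum_congr rfl fun j _ => Finset.sum_comm
  rw [schatten_two_eq_sqrt, htr, Real.sqrt_mul hn.le, frobNorm,
    inv_mul_cancel_left₀ (Real.sqrt_ne_zero'.2 hn)]

end BlockCirculant

/-! ### The norms of power sums of tensors -/

section Gauge

open scoped Matrix.Norms.L2Operator

variable {n n₃ : ℕ} [NeZero n₃]

theorem norm_gram_rpow (A : Tensor n n n₃) {r : ℝ} (hr : 0 < r) :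
    ‖mpow ((bcirc A)ᵀ * bcirc A) (r / 2)‖ = specNorm A ^ r := by
  have h : ‖(bcirc A)ᵀ * bcirc A‖ = ‖bcirc A‖ ^ (2 : ℝ) := by
    have := l2_opNorm_conjTranspose_mul_self (bcirc A)
    rw [Real.rpow_two, sq, ← this]; rfl
  rw [norm_mpow (posSemidef_gram _) (by positivity), h, ← Real.rpow_mul (norm_nonneg _), specNorm]
  congr 1; ring

theorem specNorm_nonneg (A : Tensor n n n₃) : 0 ≤ specNorm A := norm_nonneg (bcirc A)

theorem max_rpow_le_norm_powSum (A B : Tensor n n n₃) {r : ℝ} (hr : 0 < r) :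
    max (specNorm A) (specNorm B) ^ r ≤ ‖powSum r A B‖ := by
  have hA := posSemidef_mpow (posSemidef_gram (bcirc A)) (r / 2)
  have hB := posSemidef_mpow (posSemidef_gram (bcirc B)) (r / 2)
  rcases max_choice (specNorm A) (specNorm B) with h | h <;> rw [h]
  · rw [← norm_gram_rpow A hr]; exact norm_le_norm_add hA hB
  · rw [← norm_gram_rpow B hr, powSum, add_comm]; exact norm_le_norm_add hB hA

theorem norm_powSum_le (A B : Tensor n n n₃) {r : ℝ} (hr : 0 < r) :
    ‖powSum r A B‖ ≤ 2 * max (specNorm A) (specNorm B) ^ r := by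
  refine (norm_add_le _ _).trans ?_
  rw [norm_gram_rpow A hr, norm_gram_rpow B hr, two_mul]
  exact add_le_add (Real.rpow_le_rpow (specNorm_nonneg A) (le_max_left _ _) hr.le)
    (Real.rpow_le_rpow (specNorm_nonneg B) (le_max_right _ _) hr.le)

theorem tendsto_mul_rpow_rpow_one_div {k x : ℝ} (hk : 0 < k) (hx : 0 ≤ x) :
    Tendsto (fun r : ℝ => (k * x ^ r) ^ (1 / r)) atTop (𝓝 x) := by
  have h0 : Tendsto (fun r : ℝ => 1 / r) atTop (𝓝 0) := by
    simpa using tendsto_inv_atTop_zero (𝕜 := ℝ)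
  have h1 : Tendsto (fun r : ℝ => k ^ (1 / r) * x) atTop (𝓝 (k ^ (0 : ℝ) * x)) :=
    (tendsto_const_nhds.rpow h0 (Or.inl hk.ne')).mul_const x
  rw [Real.rpow_zero, one_mul] at h1
  refine h1.congr' ?_
  filter_upwards [eventually_gt_atTop 0] with r hr
  rw [Real.mul_rpow hk.le (Real.rpow_nonneg hx _), ← Real.rpow_mul hx, mul_one_div_cancel hr.ne',
    Real.rpow_one]

/-- The case `p = ∞`: any norm equivalent to the spectral norm on positive
semidefinite block circulant matrices has the same limit. -/
theorem tendsto_powNormReal {N : Tensor n n n₃ → ℝ} {a b : ℝ} (ha : 0 < a) (hb : 0 < b)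
    (hN : ∀ T : Tensor n n n₃, (bcirc T).PosSemidef →
      a * ‖bcirc T‖ ≤ N T ∧ N T ≤ b * ‖bcirc T‖) (A B : Tensor n n n₃) :
    Tendsto (fun r : ℝ => powNormReal N r A B) atTop (𝓝 (max (specNorm A) (specNorm B))) := by
  have hm : 0 ≤ max (specNorm A) (specNorm B) := le_max_of_le_left (specNorm_nonneg A)
  refine tendsto_of_tendsto_of_tendsto_of_le_of_le'
    (tendsto_mul_rpow_rpow_one_div ha hm)
    (tendsto_mul_rpow_rpow_one_div (mul_pos hb two_pos) hm) ?_ ?_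
  all_goals
    filter_upwards [eventually_gt_atTop 0] with r hr
    have hT := hN (tPow (tAbs A) r + tPow (tAbs B) r)
    rw [bcirc_tPow_add_tPow] at hT
    obtain ⟨l, u⟩ := hT (posSemidef_powSum r A B)
    have hl := mul_le_mul_of_nonneg_left (max_rpow_le_norm_powSum A B hr) ha.le
    have hu := mul_le_mul_of_nonneg_left (norm_powSum_le A B hr) hb.le
    have hmr := Real.rpow_nonneg hm r
    rw [powNormReal]
  · exact Real.rpow_le_rpow (by positivity) (hl.trans l) (by positivity)
  · refine Real.rpow_le_rpow ((mul_nonneg ha.le hmr).trans (hl.trans l)) ?_ (by positivity)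
    rw [mul_assoc]; exact u.trans hu

/-- The tensor Minkowski inequality at a finite exponent, for a norm that is a positive multiple
`k * g` of a matrix gauge. -/
theorem powNormReal_minkowski {N : Tensor n n n₃ → ℝ} {k p : ℝ} (hk : 0 < k) (hp : 1 ≤ p)
    {g h : Matrix (Fin n₃ × Fin n) (Fin n₃ × Fin n) ℝ → ℝ}
    (hN : ∀ T : Tensor n n n₃, (bcirc T).PosSemidef → N T = k * g (bcirc T))
    (hg : ∀ M : Matrix (Fin n₃ × Fin n) (Fin n₃ × Fin n) ℝ, M.PosSemidef → 0 ≤ g M)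
    (hh : ∀ M : Matrix (Fin n₃ × Fin n) (Fin n₃ × Fin n) ℝ, M.PosSemidef → 0 ≤ h M)
    (hle : p ≤ 2 → PowerComparison g h (p / 2))
    (hge : 2 ≤ p → PowerComparison h g (2 / p))
    (htri : ∀ A₁ A₂ B₁ B₂ : Matrix (Fin n₃ × Fin n) (Fin n₃ × Fin n) ℝ,
      h ((A₁ + A₂)ᵀ * (A₁ + A₂) + (B₁ + B₂)ᵀ * (B₁ + B₂)) ^ (1 / 2 : ℝ) ≤
      h (A₁ᵀ * A₁ + B₁ᵀ * B₁) ^ (1 / 2 : ℝ) + h (A₂ᵀ * A₂ + B₂ᵀ * B₂) ^ (1 / 2 : ℝ))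
    (A₁ A₂ B₁ B₂ : Tensor n n n₃) :
    (2 : ℝ) ^ (-|1 / p - 1 / 2|) * powNormReal N p (A₁ + A₂) (B₁ + B₂) ≤
      powNormReal N p A₁ B₁ + powNormReal N p A₂ B₂ := by
  have e : ∀ A B : Tensor n n n₃,
      powNormReal N p A B = k ^ (1 / p) * g (powSum p A B) ^ (1 / p) := by
    intro A B
    have hps := posSemidef_powSum p A B
    rw [powNormReal, hN _ (by rwa [bcirc_tPow_add_tPow]), bcirc_tPow_add_tPow,
      Real.mul_rpow hk.le (hg _ hps)]
  have := minkowski_of_powerComparison hp hg hh hle hge htri (bcirc A₁) (bcirc A₂) (bcirc B₁)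
    (bcirc B₂)
  rw [e, e, e, ← mul_add, mul_left_comm]
  exact mul_le_mul_of_nonneg_left this (by positivity)

theorem specNorm_add_le (A B : Tensor n n n₃) : specNorm (A + B) ≤ specNorm A + specNorm B :=
  norm_add_le (bcirc A) (bcirc B)

end Gauge

/-! ### The Frobenius and spectral norms -/

section Norms

variable {n n₃ : ℕ} [NeZero n₃]

open scoped Matrix.Norms.L2Operator in
theorem tendsto_powNormReal_frobNorm (A B : Tensor n n n₃) :
    Tendsto (fun r : ℝ => powNormReal frobNorm r A B) atTop
      (𝓝 (max (specNorm A) (specNorm B))) := by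
  have hn : (0 : ℝ) < n₃ := Nat.cast_pos.2 (NeZero.pos n₃)
  have hk : 0 < (√(n₃ : ℝ))⁻¹ := inv_pos.2 (Real.sqrt_pos.2 hn)
  -- the summand `1` keeps the upper constant positive for empty matrices
  refine tendsto_powNormReal hk
    (b := (√(n₃ : ℝ))⁻¹ * (√(Fintype.card (Fin n₃ × Fin n)) + 1)) (by positivity)
    (fun T hT => ?_) A B
  rw [frobNorm_eq hT.1, mul_assoc]
  refine ⟨mul_le_mul_of_nonneg_left (norm_le_schatten_two hT) hk.le,
    mul_le_mul_of_nonneg_left ((schatten_two_le hT).trans ?_) hk.le⟩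
  exact mul_le_mul_of_nonneg_right (le_add_of_nonneg_right zero_le_one) (norm_nonneg _)

theorem tendsto_powNormReal_specNorm (A B : Tensor n n n₃) :
    Tendsto (fun r : ℝ => powNormReal specNorm r A B) atTop
      (𝓝 (max (specNorm A) (specNorm B))) :=
  tendsto_powNormReal one_pos one_pos (fun T _ => by simp [specNorm]) A B

theorem powNormReal_frobNorm_minkowski {p : ℝ} (hp : 1 ≤ p) (A₁ A₂ B₁ B₂ : Tensor n n n₃) :
    (2 : ℝ) ^ (-|1 / p - 1 / 2|) * powNormReal frobNorm p (A₁ + A₂) (B₁ + B₂) ≤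
      powNormReal frobNorm p A₁ B₁ + powNormReal frobNorm p A₂ B₂ := by
  have hn : (0 : ℝ) < n₃ := Nat.cast_pos.2 (NeZero.pos n₃)
  have hp0 : 0 < p := by linarith
  refine powNormReal_minkowski (inv_pos.2 (Real.sqrt_pos.2 hn)) hp (g := schatten 2)
    (h := schatten p) (fun T hT => frobNorm_eq hT.1) (fun M hM => schatten_nonneg hM 2)
    (fun M hM => schatten_nonneg hM p) (fun h2 => ?_) (fun h2 => ?_)
    (fun _ _ _ _ => schatten_triangle _ _ _ _ hp) A₁ A₂ B₁ B₂
  · have e : p / 2 * 2 = p := by ring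
    simpa only [e] using powerComparison_schatten (m := Fin n₃ × Fin n) (r := p / 2) (q := 2)
      (by positivity) (by linarith) one_le_two (by linarith)
  · have e : 2 / p * p = 2 := by field_simp
    simpa only [e] using powerComparison_schatten (m := Fin n₃ × Fin n) (r := 2 / p) (q := p)
      (by positivity) ((div_le_one hp0).2 h2) hp (by linarith)

open scoped Matrix.Norms.L2Operator in
theorem powNormReal_specNorm_minkowski {p : ℝ} (hp : 1 ≤ p) (A₁ A₂ B₁ B₂ : Tensor n n n₃) :
    (2 : ℝ) ^ (-|1 / p - 1 / 2|) * powNormReal specNorm p (A₁ + A₂) (B₁ + B₂) ≤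
      powNormReal specNorm p A₁ B₁ + powNormReal specNorm p A₂ B₂ := by
  have hp0 : 0 < p := by linarith
  exact powNormReal_minkowski one_pos hp (g := fun M => ‖M‖) (h := fun M => ‖M‖)
    (fun T _ => (one_mul _).symm) (fun M _ => norm_nonneg M) (fun M _ => norm_nonneg M)
    (fun h2 => powerComparison_norm (by positivity) (by linarith))
    (fun h2 => powerComparison_norm (by positivity) ((div_le_one hp0).2 h2))
    norm_gram_triangle A₁ A₂ B₁ B₂

end Norms


end TProduct

theorem mainTheorem9 (n₁ n₃ : ℕ) [NeZero n₃]
    (N : TProduct.Tensor n₁ n₁ n₃ → ℝ)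
    (hN : N = TProduct.frobNorm ∨ N = TProduct.specNorm) :
    -- the limits that give the case `p = ∞` its meaning exist
    (∀ A B : TProduct.Tensor n₁ n₁ n₃,
      Tendsto (fun r : ℝ => TProduct.powNormReal N r A B) atTop
        (𝓝 (max (TProduct.specNorm A) (TProduct.specNorm B)))) ∧
    -- the Minkowski inequality
    (∀ p : ℝ≥0∞, 1 ≤ p → ∀ A₁ A₂ B₁ B₂ : TProduct.Tensor n₁ n₁ n₃,
      (2 : ℝ) ^ (-|(1 / p).toReal - 1 / 2|) * TProduct.powNorm N p (A₁ + A₂) (B₁ + B₂) ≤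
        TProduct.powNorm N p A₁ B₁ + TProduct.powNorm N p A₂ B₂) := by
  have hlim : ∀ A B : TProduct.Tensor n₁ n₁ n₃,
      Tendsto (fun r : ℝ => TProduct.powNormReal N r A B) atTop
        (𝓝 (max (TProduct.specNorm A) (TProduct.specNorm B))) := by
    rcases hN with rfl | rfl
    · exact TProduct.tendsto_powNormReal_frobNorm
    · exact TProduct.tendsto_powNormReal_specNorm
  refine ⟨hlim, fun p hp A₁ A₂ B₁ B₂ => ?_⟩
  by_cases htop : p = ∞
  · simp only [TProduct.powNorm, if_pos htop, (hlim _ _).limUnder_eq]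
    have h0 := (TProduct.specNorm_nonneg (A₁ + A₂)).trans
      (le_max_left _ (TProduct.specNorm (B₁ + B₂)))
    -- at `p = ∞` the maximum is itself a norm, so the constant is not needed
    refine (mul_le_of_le_one_left h0
      (Real.rpow_le_one_of_one_le_of_nonpos one_le_two (neg_nonpos.2 (abs_nonneg _)))).trans ?_
    exact max_le
      ((TProduct.specNorm_add_le A₁ A₂).trans (add_le_add (le_max_left _ _) (le_max_left _ _)))
      ((TProduct.specNorm_add_le B₁ B₂).trans (add_le_add (le_max_right _ _) (le_max_right _ _)))
  · have hp' : 1 ≤ p.toReal := by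
      simpa using ENNReal.toReal_mono htop hp
    simp only [TProduct.powNorm, if_neg htop, ENNReal.toReal_div, ENNReal.toReal_one]
    rcases hN with rfl | rfl
    · exact TProduct.powNormReal_frobNorm_minkowski hp' A₁ A₂ B₁ B₂
    · exact TProduct.powNormReal_specNorm_minkowski hp' A₁ A₂ B₁ B₂
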